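/- Let $d\ge 1$ and $N$ be integers, and let $x_{ij}$, $1\le i\le N$, $1\le j\le d$, be independent random variables, each uniformly distributed on $[-1,1]$. Let $\mathbf p_i=(x_{i1},\dots,x_{id})\in[-1,1]^d$, and let $\boldsymbol\Delta\in\mathbb R^{N\times N}$ be the Euclidean distance matrix of these points, $\boldsymbol\Delta(i,j)=\|\mathbf p_i-\mathbf p_j\|_2^2$, whose rank is always at most $d+2$. Put $$\zeta=5d^2+4d+45,\qquad \theta=\frac{90(1+d+d^2)}{\zeta-\sqrt{\zeta^2-720d}} .$$ Let $t\in(0,1)$ and $\gamma\in(0,1]$. If $$N\ \ge\ \frac{2\theta\left(\log(d+2)-\log\gamma\right)}{(1-t)^2},$$ then, with probability at least $1-\gamma$, the matrix $\boldsymbol\Delta$ satisfies assumptions A0 and A1 with the constants $$\mu_0=\frac{\theta}{t(d+2)}\qquad\text{and}\qquad \mu_1=\frac{\theta}{t\sqrt{d+2}} .$$ Here, for a matrix $\mathbf M\in\mathbb R^{K\times L}$ of rank $r$ with compact singular value decomposition $\mathbf M=\sum_{k=1}^r\sigma_k\mathbf u_k\mathbf v_k^{T}$ (orthonormal $\mathbf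 u_k$, orthonormal $\mathbf v_k$, $\sigma_k>0$), column space $U$ and row space $V$, and constants $\mu_0,\mu_1>0$: A0: $\max\{\mu(U),\mu(V)\}\le\mu_0$, where the coherence of an $r$-dimensional subspace $W\subseteq\mathbb R^n$ is $\mu(W)=\frac nr\max_{1\le i\le n}\|\mathbf P_W\mathbf e_i\|_2^2$, with $\mathbf P_W$ the orthogonal projection onto $W$ and $\mathbf e_i$ the standard basis vectors. A1: every entry of $\sum_{k=1}^r\mathbf u_k\mathbf v_k^{T}$ has absolute value at most $\mu_1\sqrt{r/(KL)}$. -/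

import Mathlib

open MeasureTheory ProbabilityTheory

namespace RandomEDM

noncomputable section

/-- The Euclidean distance matrix of the points `p 1, …, p N` of `ℝ^d`: its `(i, j)` entry is the
squared Euclidean distance `‖p i - p j‖²`. -/
def edm {N d : ℕ} (p : Fin N → EuclideanSpace ℝ (Fin d)) : Matrix (Fin N) (Fin N) ℝ :=
  Matrix.of fun i j => ‖p i - p j‖ ^ 2

/-- The column space of a real matrix, as a subspace of Euclidean space. -/
def colSpace {K L : ℕ} (M : Matrix (Fin K) (Fin L) ℝ) :
    Submodule ℝ (EuclideanSpace ℝ (Fin K)) :=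
  Submodule.span ℝ (Set.range fun j : Fin L => WithLp.toLp 2 fun i : Fin K => M i j)

/-- The row space of a real matrix, as a subspace of Euclidean space. -/
def rowSpace {K L : ℕ} (M : Matrix (Fin K) (Fin L) ℝ) :
    Submodule ℝ (EuclideanSpace ℝ (Fin L)) :=
  Submodule.span ℝ (Set.range fun i : Fin K => WithLp.toLp 2 fun j : Fin L => M i j)

/-- The coherence `μ(U) = (N / r) * sup_i ‖P_U e_i‖²` of an `r`-dimensional subspace `U` of `ℝ^N`
with respect to the standard basis, where `P_U` is the orthogonal projection onto `U`. -/
def coherence {N : ℕ} (U : Submodule ℝ (EuclideanSpace ℝ (Fin N))) : ℝ :=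
  (N : ℝ) / (Module.finrank ℝ U : ℝ) *
    ⨆ i : Fin N, ‖U.starProjection (EuclideanSpace.single i (1 : ℝ))‖ ^ 2

/-- `M = U Σ Vᵀ = ∑ k, σ k • u_k v_kᵀ` is a compact singular value decomposition of `M`: the
number of terms is the rank of `M`, the columns `u_k` of `U` are orthonormal, so are the columns
`v_k` of `V`, and the singular values `σ k` are positive. -/
structure IsCompactSVD {K L : ℕ} (M : Matrix (Fin K) (Fin L) ℝ)
    (U : Matrix (Fin K) (Fin M.rank) ℝ) (σ : Fin M.rank → ℝ)
    (V : Matrix (Fin L) (Fin M.rank) ℝ) : Prop where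
  orthonormal_left : U.transpose * U = 1
  orthonormal_right : V.transpose * V = 1
  pos : ∀ k, 0 < σ k
  eq_mul : M = U * Matrix.diagonal σ * V.transpose

/-- Assumption A0 with constant `μ₀ > 0`: the column space and the row space of `M` have coherence
at most `μ₀`. -/
def AssumptionA0 {K L : ℕ} (M : Matrix (Fin K) (Fin L) ℝ) (μ₀ : ℝ) : Prop :=
  0 < μ₀ ∧ max (coherence (colSpace M)) (coherence (rowSpace M)) ≤ μ₀

/-- Assumption A1 with constant `μ₁ > 0`: every entry of `∑ k, u_k v_kᵀ = U Vᵀ` is at most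
`μ₁ √(r / (K L))` in absolute value, where `r` is the rank of `M` and the `u_k`, `v_k` are the
singular vectors of a compact singular value decomposition of `M`. The matrix `U Vᵀ` does not
depend on the choice of the decomposition; the bound is asked for all of them, and one is asked
to exist, so that the condition never holds vacuously. -/
def AssumptionA1 {K L : ℕ} (M : Matrix (Fin K) (Fin L) ℝ) (μ₁ : ℝ) : Prop :=
  0 < μ₁ ∧
  (∃ U σ V, IsCompactSVD M U σ V) ∧
  ∀ U σ V, IsCompactSVD M U σ V →
    ∀ i j, |(U * V.transpose) i j| ≤ μ₁ * √((M.rank : ℝ) / ((K : ℝ) * (L : ℝ)))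

/-- `ζ = 5 d² + 4 d + 45`. -/
def zeta (d : ℕ) : ℝ := 5 * (d : ℝ) ^ 2 + 4 * (d : ℝ) + 45

/-- `θ = 90 (1 + d + d²) / (ζ - √(ζ² - 720 d))`. -/
def theta (d : ℕ) : ℝ :=
  90 * (1 + (d : ℝ) + (d : ℝ) ^ 2) / (zeta d - √(zeta d ^ 2 - 720 * (d : ℝ)))

end

end RandomEDM

/-! Put φ(p) = (1, ‖p‖², p) and let X be the matrix with rows φ(pᵢ). Squared distance is a bilinear
form in the features, so Δ = X B Xᵀ with B invertible of size d + 2 (`edm_eq_mul`). Suppose XᵀX ≥ c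
> 0. Then Δ has rank exactly d + 2 (`rank_edm_eq`). On the cube ‖φ‖² ≤ R = 1 + d + d², so the
projection y = Xa of eᵢ onto the column space satisfies yᵢ = ‖y‖² and yᵢ² ≤ R‖a‖² ≤ (R/c) yᵢ, whence
‖y‖² ≤ R/c (`apply_le_of_eq_dotProduct_self`). This is A0; the same bound on the rows of U and V
gives A1 by Cauchy–Schwarz (`assumptions_edm`).

It remains to get c = tNλ with probability at least 1 - γ, where λ is `minEig` and θ = R/λ. Here XᵀX
is a sum of N independent rank-one matrices, each with expectation at least λ, so a lower-tail
matrix Chernoff bound is needed. In E tr exp(-s XᵀX), Golden–Thompson splits off one summand at a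
time, each contributing a factor at most 1 - (1 - e^(-sR))λ/R
(`lintegral_trace_exp_sub_gramSum_le`); Markov's inequality with e^(-sR) = t then concludes.
Golden–Thompson itself comes from a trace inequality for powers 2^k and the Lie–Trotter formula. -/

namespace RandomEDM

open Matrix Filter Topology

/-! ### Trace inequalities for powers of products -/

section TracePowers

variable {n : Type*} [Fintype n]

lemma trace_mul_transpose_self_nonneg (M : Matrix n n ℝ) : 0 ≤ (M * Mᵀ).trace := by
  simp only [trace, diag_apply, mul_apply, transpose_apply]
  exact Finset.sum_nonneg fun i _ => Finset.sum_nonneg fun j _ => mul_self_nonneg _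

lemma trace_mul_le_of_isSymm {P Q : Matrix n n ℝ} (hP : P.IsSymm) (hQ : Q.IsSymm) :
    (P * Q).trace ≤ ((P * P).trace + (Q * Q).trace) / 2 := by
  have h := trace_mul_transpose_self_nonneg (P - Q)
  rw [transpose_sub, hP.eq, hQ.eq, sub_mul, mul_sub, mul_sub, trace_sub, trace_sub, trace_sub,
    trace_mul_comm Q P] at h
  linarith

lemma trace_mul_self_le (M : Matrix n n ℝ) : (M * M).trace ≤ (M * Mᵀ).trace := by
  have h := trace_mul_transpose_self_nonneg (M - Mᵀ)
  have h2 : (Mᵀ * Mᵀ).trace = (M * M).trace := by rw [← transpose_mul, trace_transpose]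
  rw [transpose_sub, transpose_transpose, sub_mul, mul_sub, mul_sub, trace_sub, trace_sub,
    trace_sub, trace_mul_comm Mᵀ M, h2] at h
  linarith

variable [DecidableEq n]

lemma trace_mul_pow_comm (X Y : Matrix n n ℝ) (k : ℕ) :
    ((X * Y) ^ k).trace = ((Y * X) ^ k).trace := by
  cases k with
  | zero => simp
  | succ k =>
    have h : (X * Y) ^ k * X = X * (Y * X) ^ k := by
      have : SemiconjBy X (Y * X) (X * Y) := by simp [SemiconjBy, mul_assoc]
      exact (this.pow_right k).symm
    rw [pow_succ, ← mul_assoc, h, trace_mul_comm, ← mul_assoc, ← pow_succ']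

/-- The two claims feed each other. The second, applied to `P * Q`, reduces by cyclicity to the
first for Q², P². The second for `M`, applied through M², reduces by cyclicity to the first for `M *
Mᵀ` and `Mᵀ * M`, whose powers have equal traces. -/
lemma trace_pow_two_pow_le (k : ℕ) :
    (∀ P Q : Matrix n n ℝ, P.IsSymm → Q.IsSymm →
      ((P * Q) ^ 2 ^ k).trace ≤ (P ^ 2 ^ k * Q ^ 2 ^ k).trace) ∧
    ∀ M : Matrix n n ℝ, (M ^ 2 ^ (k + 1)).trace ≤ ((M * Mᵀ) ^ 2 ^ k).trace := by
  induction k with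
  | zero =>
    refine ⟨fun P Q _ _ => by simp, fun M => ?_⟩
    simpa [pow_two] using trace_mul_self_le M
  | succ k ih =>
    obtain ⟨hb, ha⟩ := ih
    refine ⟨fun P Q hP hQ => ?_, fun M => ?_⟩
    · refine (ha (P * Q)).trans ?_
      have h1 : P * Q * (P * Q)ᵀ = P * (Q * Q * P) := by
        rw [transpose_mul, hP.eq, hQ.eq]; simp only [mul_assoc]
      have h2 : Q * Q * P * P = Q ^ 2 * P ^ 2 := by simp only [pow_two, mul_assoc]
      rw [h1, trace_mul_pow_comm, h2]
      refine (hb _ _ (hQ.pow 2) (hP.pow 2)).trans (le_of_eq ?_)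
      rw [← pow_mul, ← pow_mul, ← pow_succ', trace_mul_comm]
    · have h0 : M ^ 2 ^ (k + 1 + 1) = (M ^ 2) ^ 2 ^ (k + 1) := by rw [← pow_mul, ← pow_succ']
      have h1 : M ^ 2 * (M ^ 2)ᵀ = M * (M * Mᵀ * Mᵀ) := by
        simp only [pow_two, transpose_mul, mul_assoc]
      have h2 : M * Mᵀ * Mᵀ * M = (M * Mᵀ) * (Mᵀ * M) := by simp only [mul_assoc]
      have hs1 : (M * Mᵀ).IsSymm := by simp [IsSymm, transpose_mul]
      have hs2 : (Mᵀ * M).IsSymm := by simp [IsSymm, transpose_mul]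
      rw [h0]
      refine (ha (M ^ 2)).trans ?_
      rw [h1, trace_mul_pow_comm, h2]
      refine (hb _ _ hs1 hs2).trans ?_
      refine (trace_mul_le_of_isSymm (hs1.pow _) (hs2.pow _)).trans (le_of_eq ?_)
      rw [← pow_add, ← pow_add, ← two_mul, ← pow_succ', trace_mul_pow_comm Mᵀ M]
      ring

end TracePowers

/-! ### The Lie–Trotter product formula -/

section Trotter

open NormedSpace

variable {𝔸 : Type*} [NormedRing 𝔸] [NormOneClass 𝔸]

lemma norm_pow_sub_pow_le {x y : 𝔸} {K : ℝ} (hK : 1 ≤ K) (hx : ‖x‖ ≤ K) (hy : ‖y‖ ≤ K) (m : ℕ) :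
    ‖x ^ m - y ^ m‖ ≤ m * K ^ m * ‖x - y‖ := by
  induction m with
  | zero => simp
  | succ m ih =>
    have h : x ^ (m + 1) - y ^ (m + 1) = x ^ m * (x - y) + (x ^ m - y ^ m) * y := by
      rw [pow_succ, pow_succ]; noncomm_ring
    have hK0 : 0 ≤ K := by linarith
    calc ‖x ^ (m + 1) - y ^ (m + 1)‖ ≤ ‖x ^ m‖ * ‖x - y‖ + ‖x ^ m - y ^ m‖ * ‖y‖ := by
          rw [h]
          exact (norm_add_le _ _).trans (add_le_add (norm_mul_le _ _) (norm_mul_le _ _))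
      _ ≤ K ^ (m + 1) * ‖x - y‖ + (m * K ^ m * ‖x - y‖) * K := by
          gcongr
          exact ((norm_pow_le x m).trans (pow_le_pow_left₀ (norm_nonneg _) hx m)).trans
            (pow_le_pow_right₀ hK (Nat.le_succ m))
      _ = _ := by push_cast; ring

variable [NormedAlgebra ℝ 𝔸] [CompleteSpace 𝔸]

lemma norm_exp_le_exp_norm (x : 𝔸) : ‖exp x‖ ≤ Real.exp ‖x‖ := by
  let _ : NormedAlgebra ℚ 𝔸 := NormedAlgebra.restrictScalars ℚ ℝ 𝔸
  rw [Real.exp_eq_exp_ℝ]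
  refine (exp_series_hasSum_exp' (𝕂 := ℝ) x).norm_le_of_bounded
    (exp_series_hasSum_exp' (𝕂 := ℝ) ‖x‖) fun k => ?_
  rw [norm_smul, norm_inv, RCLike.norm_natCast, smul_eq_mul]
  gcongr
  exact norm_pow_le x k

/-- The m-th root factors differ by f(1/m) = o(1/m), because f vanishes to first order at 0;
telescoping the m-th powers multiplies this error by at most m times a constant. -/
lemma tendsto_exp_mul_exp_pow (A B : 𝔸) :
    Tendsto (fun m : ℕ => (exp ((m : ℝ)⁻¹ • A) * exp ((m : ℝ)⁻¹ • B)) ^ m) atTop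
      (𝓝 (exp (A + B))) := by
  let _ : NormedAlgebra ℚ 𝔸 := NormedAlgebra.restrictScalars ℚ ℝ 𝔸
  set f : ℝ → 𝔸 := fun s => exp (s • A) * exp (s • B) - exp (s • (A + B)) with hf
  have hderiv : HasDerivAt f 0 0 := by
    have h := ((hasDerivAt_exp_smul_const A (0 : ℝ)).mul
      (hasDerivAt_exp_smul_const B (0 : ℝ))).sub (hasDerivAt_exp_smul_const (A + B) (0 : ℝ))
    refine h.congr_deriv ?_
    simp [exp_zero]
  have hlim : Tendsto (fun m : ℕ => (m : ℝ) * ‖f (m : ℝ)⁻¹‖) atTop (𝓝 0) := by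
    have h1 := hderiv.isLittleO
    have hf0 : f 0 = 0 := by simp [hf, exp_zero]
    simp only [hf0, sub_zero, smul_zero] at h1
    have h2 : Tendsto (fun m : ℕ => (m : ℝ)⁻¹) atTop (𝓝 0) := tendsto_inv_atTop_nhds_zero_nat
    have h3 := (h1.comp_tendsto h2).norm_left.tendsto_div_nhds_zero
    refine h3.congr fun m => ?_
    simp [div_eq_mul_inv, mul_comm]
  rw [tendsto_iff_norm_sub_tendsto_zero]
  set C := Real.exp (‖A‖ + ‖B‖) with hC
  have hlim2 : Tendsto (fun m : ℕ => C * ((m : ℝ) * ‖f (m : ℝ)⁻¹‖)) atTop (𝓝 0) := by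
    simpa using hlim.const_mul C
  refine squeeze_zero' (Eventually.of_forall fun _ => norm_nonneg _) ?_ hlim2
  filter_upwards [eventually_gt_atTop 0] with m hm
  have hm' : (0 : ℝ) < m := by exact_mod_cast hm
  have hexp : exp (A + B) = (exp ((m : ℝ)⁻¹ • (A + B))) ^ m := by
    rw [← NormedSpace.exp_nsmul, ← Nat.cast_smul_eq_nsmul ℝ, smul_smul, mul_inv_cancel₀ hm'.ne',
      one_smul]
  have hnorm : ∀ D : 𝔸, ‖exp ((m : ℝ)⁻¹ • D)‖ ≤ Real.exp ((m : ℝ)⁻¹ * ‖D‖) := fun D => by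
    refine (norm_exp_le_exp_norm _).trans (le_of_eq ?_)
    rw [norm_smul, norm_inv, RCLike.norm_natCast]
  -- `K` bounds both m-th root factors, and its m-th power does not depend on m.
  set K := Real.exp ((m : ℝ)⁻¹ * (‖A‖ + ‖B‖)) with hKdef
  have hK : K ^ m = C := by
    rw [hKdef, hC, ← Real.exp_nat_mul]
    congr 1
    field_simp
  have hb := norm_pow_sub_pow_le (x := exp ((m : ℝ)⁻¹ • A) * exp ((m : ℝ)⁻¹ • B))
    (y := exp ((m : ℝ)⁻¹ • (A + B))) (K := K)
    (Real.one_le_exp (by positivity))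
    ((norm_mul_le _ _).trans (by
      rw [hKdef, mul_add, Real.exp_add]
      exact mul_le_mul (hnorm A) (hnorm B) (norm_nonneg _) (Real.exp_nonneg _)))
    ((hnorm _).trans (Real.exp_le_exp.mpr (by gcongr; exact norm_add_le _ _))) m
  rw [hexp]
  refine hb.trans (le_of_eq ?_)
  rw [hK]
  ring

end Trotter

/-! ### The Golden–Thompson inequality -/

section GoldenThompson

open NormedSpace

variable {n : Type*} [Fintype n] [DecidableEq n] [Nonempty n]

theorem golden_thompson {A B : Matrix n n ℝ} (hA : A.IsSymm) (hB : B.IsSymm) :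
    (exp (A + B)).trace ≤ (exp A * exp B).trace := by
  have hT : Tendsto (fun m : ℕ => (exp ((m : ℝ)⁻¹ • A) * exp ((m : ℝ)⁻¹ • B)) ^ m) atTop
      (𝓝 (exp (A + B))) := by
    let _ : NormedRing (Matrix n n ℝ) := Matrix.linftyOpNormedRing
    let _ : NormedAlgebra ℝ (Matrix n n ℝ) := Matrix.linftyOpNormedAlgebra
    have : NormOneClass (Matrix n n ℝ) := Matrix.linfty_opNormOneClass
    exact tendsto_exp_mul_exp_pow A B
  -- The trace inequality is known only for exponents 2^k, so the limit is taken along that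
  -- subsequence.
  have hT2 := ((continuous_id.matrix_trace.tendsto _).comp hT).comp
    (tendsto_pow_atTop_atTop_of_one_lt (one_lt_two : 1 < 2))
  refine le_of_tendsto hT2 (Eventually.of_forall fun k => ?_)
  have hpow : ∀ D : Matrix n n ℝ, exp ((((2 ^ k : ℕ) : ℝ))⁻¹ • D) ^ 2 ^ k = exp D := fun D => by
    rw [← Matrix.exp_nsmul, ← Nat.cast_smul_eq_nsmul ℝ, smul_smul,
      mul_inv_cancel₀ (by positivity), one_smul]
  have h := (trace_pow_two_pow_le k).1 _ _ (hA.smul (((2 ^ k : ℕ) : ℝ))⁻¹).exp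
    (hB.smul (((2 ^ k : ℕ) : ℝ))⁻¹).exp
  rw [hpow, hpow] at h
  exact h

end GoldenThompson

end RandomEDM

namespace RandomEDM

open Matrix NormedSpace

lemma isSymm_vecMulVec_self {n : Type*} (v : n → ℝ) : (vecMulVec v v).IsSymm :=
  transpose_vecMulVec v v

/-! ### Exponentials of symmetric and rank-one matrices -/

section MatrixExponential

variable {n : Type*} [Fintype n] [DecidableEq n]

lemma continuous_matrix_exp : Continuous (exp : Matrix n n ℝ → Matrix n n ℝ) := by
  let _ : NormedRing (Matrix n n ℝ) := Matrix.linftyOpNormedRing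
  let _ : NormedAlgebra ℝ (Matrix n n ℝ) := Matrix.linftyOpNormedAlgebra
  let _ : NormedAlgebra ℚ (Matrix n n ℝ) := NormedAlgebra.restrictScalars ℚ ℝ _
  exact NormedSpace.exp_continuous

lemma exp_smul_of_isIdempotentElem {P : Matrix n n ℝ} (hP : IsIdempotentElem P) (a : ℝ) :
    exp (a • P) = 1 + (Real.exp a - 1) • P := by
  let _ : NormedRing (Matrix n n ℝ) := Matrix.linftyOpNormedRing
  let _ : NormedAlgebra ℝ (Matrix n n ℝ) := Matrix.linftyOpNormedAlgebra
  let _ : NormedAlgebra ℚ (Matrix n n ℝ) := NormedAlgebra.restrictScalars ℚ ℝ _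
  have h1 := exp_series_hasSum_exp' (𝕂 := ℝ) (a • P)
  -- All positive powers of `P` equal `P`; the added term `1 - P` corrects index 0, where the power
  -- is 1.
  have h2 := ((exp_series_hasSum_exp' (𝕂 := ℝ) a).smul_const P).add
    (hasSum_ite_eq (0 : ℕ) (1 - P))
  rw [← Real.exp_eq_exp_ℝ] at h2
  have h3 : (fun k : ℕ => ((k.factorial : ℝ)⁻¹ • (a • P) ^ k : Matrix n n ℝ)) =
      fun k : ℕ => ((k.factorial : ℝ)⁻¹ • a ^ k) • P + if k = 0 then 1 - P else 0 := by
    funext k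
    rcases Nat.eq_zero_or_pos k with rfl | hk
    · simp
    · obtain ⟨m, rfl⟩ := Nat.exists_eq_succ_of_ne_zero hk.ne'
      rw [smul_pow, hP.pow_succ_eq, smul_smul, if_neg (Nat.succ_ne_zero m), add_zero, smul_eq_mul]
  rw [h3] at h1
  refine (h1.unique h2).trans ?_
  rw [sub_smul, one_smul]
  abel

lemma exp_smul_vecMulVec {v : n → ℝ} (hv : v ⬝ᵥ v ≠ 0) (s : ℝ) :
    exp (-(s • vecMulVec v v)) =
      1 - ((1 - Real.exp (-(s * (v ⬝ᵥ v)))) / (v ⬝ᵥ v)) • vecMulVec v v := by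
  have hP : IsIdempotentElem ((v ⬝ᵥ v)⁻¹ • vecMulVec v v) := by
    rw [IsIdempotentElem, smul_mul_smul_comm, vecMulVec_mul_vecMulVec, vecMulVec_smul, smul_smul]
    congr 1
    field_simp
  have h := exp_smul_of_isIdempotentElem hP (-(s * (v ⬝ᵥ v)))
  rw [smul_smul, smul_smul] at h
  have h1 : -(s * (v ⬝ᵥ v)) * (v ⬝ᵥ v)⁻¹ = -s := by field_simp
  rw [h1, neg_smul] at h
  rw [h, sub_eq_add_neg (1 : Matrix n n ℝ), ← neg_smul]
  congr 2
  field_simp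
  ring

lemma exp_eq_half_mul_half (H : Matrix n n ℝ) :
    exp H = exp ((1 / 2 : ℝ) • H) * exp ((1 / 2 : ℝ) • H) := by
  rw [← Matrix.exp_add_of_commute _ _ (Commute.refl _), ← add_smul]
  norm_num

/-- With F = exp(H/2) symmetric, exp H = F Fᵀ. Writing traces through the rows of F lets
second-moment bounds for single vectors be applied row by row. -/
lemma trace_exp_eq_sum {H : Matrix n n ℝ} (hH : H.IsSymm) :
    (exp H).trace = ∑ k, exp ((1 / 2 : ℝ) • H) k ⬝ᵥ exp ((1 / 2 : ℝ) • H) k := by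
  have hF := (hH.smul (1 / 2 : ℝ)).exp
  rw [exp_eq_half_mul_half]
  nth_rw 2 [← hF.eq]
  simp [trace, mul_apply, dotProduct]

lemma trace_exp_nonneg {H : Matrix n n ℝ} (hH : H.IsSymm) : 0 ≤ (exp H).trace := by
  rw [trace_exp_eq_sum hH]
  exact Finset.sum_nonneg fun k _ => Finset.sum_nonneg fun j _ => mul_self_nonneg _

lemma trace_exp_mul_vecMulVec {H : Matrix n n ℝ} (hH : H.IsSymm) (v : n → ℝ) :
    (exp H * vecMulVec v v).trace = ∑ k, (exp ((1 / 2 : ℝ) • H) k ⬝ᵥ v) ^ 2 := by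
  have hF := (hH.smul (1 / 2 : ℝ)).exp
  have h : exp ((1 / 2 : ℝ) • H) * vecMulVec v v * exp ((1 / 2 : ℝ) • H) =
      vecMulVec (exp ((1 / 2 : ℝ) • H) *ᵥ v) (exp ((1 / 2 : ℝ) • H) *ᵥ v) := by
    rw [mul_vecMulVec, vecMulVec_mul]
    congr 1
    nth_rw 1 [← hF.eq]
    rw [vecMul_transpose]
  rw [exp_eq_half_mul_half, mul_assoc, trace_mul_comm, h]
  simp [trace, vecMulVec_apply, mulVec, pow_two]

/-- Convexity of exp, with -su written as a convex combination of -sR and 0. -/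
lemma one_sub_exp_div_le {u R : ℝ} (s : ℝ) (hu : 0 < u) (huR : u ≤ R) :
    (1 - Real.exp (-(s * R))) / R ≤ (1 - Real.exp (-(s * u))) / u := by
  have hR : 0 < R := hu.trans_le huR
  have h := convexOn_exp.2 (Set.mem_univ (-(s * R))) (Set.mem_univ (0 : ℝ))
    (show 0 ≤ u / R by positivity) (show 0 ≤ 1 - u / R by rw [sub_nonneg, div_le_one hR]; exact huR)
    (by ring)
  have h1 : (u / R) • (-(s * R)) + (1 - u / R) • (0 : ℝ) = -(s * u) := by
    simp only [smul_eq_mul]; field_simp; ring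
  rw [h1, Real.exp_zero, smul_eq_mul, smul_eq_mul] at h
  rw [div_le_div_iff₀ hR hu]
  have h2 := mul_le_mul_of_nonneg_right h hR.le
  have h3 : (u / R * Real.exp (-(s * R)) + (1 - u / R) * 1) * R =
      u * Real.exp (-(s * R)) + (R - u) := by field_simp
  rw [h3] at h2
  linarith

lemma trace_exp_sub_vecMulVec_le [Nonempty n] {H : Matrix n n ℝ} (hH : H.IsSymm) {v : n → ℝ}
    {R : ℝ} (s : ℝ) (hv : 0 < v ⬝ᵥ v) (hvR : v ⬝ᵥ v ≤ R) :
    (exp (H - s • vecMulVec v v)).trace ≤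
      (exp H).trace -
        (1 - Real.exp (-(s * R))) / R * ∑ k, (exp ((1 / 2 : ℝ) • H) k ⬝ᵥ v) ^ 2 := by
  have h := golden_thompson hH ((isSymm_vecMulVec_self v).smul s).neg
  rw [← sub_eq_add_neg, exp_smul_vecMulVec hv.ne', mul_sub, mul_one, Matrix.mul_smul, trace_sub,
    trace_smul, trace_exp_mul_vecMulVec hH, smul_eq_mul] at h
  refine h.trans (sub_le_sub_left (mul_le_mul_of_nonneg_right (one_sub_exp_div_le s hv hvR) ?_) _)
  exact Finset.sum_nonneg fun k _ => sq_nonneg _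

/-- The trace is the sum of the positive numbers e^μ over the eigenvalues μ of `A`, so each μ is at
most c. -/
lemma dotProduct_mulVec_le_of_trace_exp_lt {A : Matrix n n ℝ} (hA : A.IsSymm) {c : ℝ}
    (h : (exp A).trace < Real.exp c) (v : n → ℝ) : v ⬝ᵥ (A *ᵥ v) ≤ c * (v ⬝ᵥ v) := by
  have hH : A.IsHermitian := by rw [IsHermitian, conjTranspose_eq_transpose_of_trivial]; exact hA
  set U : Matrix n n ℝ := (hH.eigenvectorUnitary : Matrix n n ℝ) with hU
  have hU1 : U * star U = 1 := Unitary.coe_mul_star_self _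
  have hU2 : star U * U = 1 := Unitary.coe_star_mul_self _
  have hinv : U⁻¹ = star U := Matrix.inv_eq_right_inv hU1
  have hspec : A = U * diagonal hH.eigenvalues * star U := by
    have := hH.spectral_theorem
    rw [Unitary.conjStarAlgAut_apply] at this
    simpa using this
  have hunit : IsUnit U := ⟨⟨U, star U, hU1, hU2⟩, rfl⟩
  have htr : (exp A).trace = ∑ i, Real.exp (hH.eigenvalues i) := by
    conv_lhs => rw [hspec, ← hinv, Matrix.exp_conj _ _ hunit, hinv, trace_mul_cycle, hU2, one_mul,
      Matrix.exp_diagonal]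
    simp [trace, Pi.coe_exp, Real.exp_eq_exp_ℝ]
  have heig : ∀ i, hH.eigenvalues i ≤ c := fun i => by
    rw [← Real.exp_le_exp]
    refine le_trans ?_ (htr ▸ h.le)
    exact Finset.single_le_sum (f := fun i => Real.exp (hH.eigenvalues i))
      (fun j _ => (Real.exp_pos _).le) (Finset.mem_univ i)
  set w := star U *ᵥ v with hw
  have hvU : v ᵥ* U = w := by
    rw [hw, star_eq_conjTranspose, conjTranspose_eq_transpose_of_trivial, mulVec_transpose]
  have h1 : v ⬝ᵥ (A *ᵥ v) = ∑ i, hH.eigenvalues i * w i ^ 2 := by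
    conv_lhs => rw [hspec, ← mulVec_mulVec, ← mulVec_mulVec, dotProduct_mulVec, ← hw, hvU]
    simp only [dotProduct, mulVec_diagonal]
    exact Finset.sum_congr rfl fun i _ => by ring
  have h2 : v ⬝ᵥ v = ∑ i, w i ^ 2 := by
    have : v ⬝ᵥ v = w ⬝ᵥ w := by
      nth_rw 2 [hw]
      rw [← hvU, ← dotProduct_mulVec, mulVec_mulVec, hU1, one_mulVec]
    rw [this]
    simp [dotProduct, pow_two]
  rw [h1, h2, Finset.mul_sum]
  exact Finset.sum_le_sum fun i _ => mul_le_mul_of_nonneg_right (heig i) (sq_nonneg _)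

end MatrixExponential

end RandomEDM

namespace RandomEDM

open Matrix NormedSpace

/-! ### The lower-tail matrix Chernoff bound -/

section MatrixChernoff

variable {n V : Type*}

/-- The sum `∑ i, φ(y i) φ(y i)ᵀ` of rank-one matrices. -/
noncomputable def gramSum (φ : V → n → ℝ) {N : ℕ} (y : Fin N → V) : Matrix n n ℝ :=
  ∑ i, vecMulVec (φ (y i)) (φ (y i))

lemma isSymm_gramSum (φ : V → n → ℝ) {N : ℕ} (y : Fin N → V) : (gramSum φ y).IsSymm := by
  rw [IsSymm, gramSum, transpose_sum]
  exact Finset.sum_congr rfl fun i _ => isSymm_vecMulVec_self _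

lemma gramSum_succ (φ : V → n → ℝ) {N : ℕ} (y : Fin (N + 1) → V) :
    gramSum φ y = vecMulVec (φ (y 0)) (φ (y 0)) + gramSum φ fun i => y i.succ :=
  Fin.sum_univ_succ _

lemma continuous_gramSum [TopologicalSpace V] {φ : V → n → ℝ} (hφ : Continuous φ) {N : ℕ} :
    Continuous fun y : Fin N → V => gramSum φ y :=
  continuous_finsetSum _ fun i _ =>
    (hφ.comp (continuous_apply i)).matrix_vecMulVec (hφ.comp (continuous_apply i))

variable [DecidableEq n] [Fintype n]
lemma continuous_trace_exp_gramSum [TopologicalSpace V] {φ : V → n → ℝ} (hφ : Continuous φ)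
    (s : ℝ) {N : ℕ} :
    Continuous fun y : Fin N → V => (exp (-(s • gramSum φ y))).trace :=
  (continuous_matrix_exp.comp ((continuous_gramSum hφ).const_smul s).neg).matrix_trace

variable [MeasurableSpace V] {ν : Measure V} [IsProbabilityMeasure ν] {φ : V → n → ℝ} {R lam s : ℝ}

/-- One random summand shrinks the expected trace by a fixed factor: after Golden–Thompson the bound
is affine in φφᵀ, so only the second moment enters. -/
lemma lintegral_trace_exp_sub_vecMulVec_le [Nonempty n] (hs : 0 ≤ s) (hR : 0 < R)
    (hbound : ∀ᵐ y ∂ν, 0 < φ y ⬝ᵥ φ y ∧ φ y ⬝ᵥ φ y ≤ R)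
    (hint : ∀ w : n → ℝ, Integrable (fun y => (w ⬝ᵥ φ y) ^ 2) ν)
    (hlow : ∀ w : n → ℝ, lam * (w ⬝ᵥ w) ≤ ∫ y, (w ⬝ᵥ φ y) ^ 2 ∂ν)
    {H : Matrix n n ℝ} (hH : H.IsSymm) :
    ∫⁻ y, ENNReal.ofReal (exp (H - s • vecMulVec (φ y) (φ y))).trace ∂ν ≤
      ENNReal.ofReal ((1 - (1 - Real.exp (-(s * R))) / R * lam) * (exp H).trace) := by
  set g := (1 - Real.exp (-(s * R))) / R with hg
  have hg0 : 0 ≤ g := div_nonneg (by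
    rw [sub_nonneg, Real.exp_le_one_iff]; nlinarith) hR.le
  set f : V → ℝ := fun y =>
    (exp H).trace - g * ∑ k, (exp ((1 / 2 : ℝ) • H) k ⬝ᵥ φ y) ^ 2 with hf
  have hle : ∀ᵐ y ∂ν, (exp (H - s • vecMulVec (φ y) (φ y))).trace ≤ f y := by
    filter_upwards [hbound] with y hy
    exact trace_exp_sub_vecMulVec_le hH s hy.1 hy.2
  have hsum : Integrable (fun y => ∑ k, (exp ((1 / 2 : ℝ) • H) k ⬝ᵥ φ y) ^ 2) ν :=
    integrable_finsetSum _ fun k _ => hint _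
  have hfint : Integrable f ν := (integrable_const _).sub (hsum.const_mul g)
  -- `f` dominates a nonnegative trace; this is what allows passing from the lower integral to the
  -- Bochner integral.
  have hf0 : 0 ≤ᵐ[ν] f := by
    filter_upwards [hle] with y hy
    exact (trace_exp_nonneg (hH.sub ((isSymm_vecMulVec_self _).smul s))).trans hy
  calc _ ≤ ∫⁻ y, ENNReal.ofReal (f y) ∂ν :=
        lintegral_mono_ae (hle.mono fun y hy => ENNReal.ofReal_le_ofReal hy)
    _ = ENNReal.ofReal (∫ y, f y ∂ν) := (ofReal_integral_eq_lintegral_ofReal hfint hf0).symm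
    _ ≤ _ := by
      refine ENNReal.ofReal_le_ofReal ?_
      rw [hf, integral_sub (integrable_const _) (hsum.const_mul g), integral_const_mul]
      have hI : ∫ y, ∑ k, (exp ((1 / 2 : ℝ) • H) k ⬝ᵥ φ y) ^ 2 ∂ν =
          ∑ k, ∫ y, (exp ((1 / 2 : ℝ) • H) k ⬝ᵥ φ y) ^ 2 ∂ν :=
        integral_finsetSum _ fun k _ => hint _
      rw [hI]
      simp only [integral_const, probReal_univ, one_smul]
      have h : lam * (exp H).trace ≤
          ∑ k, ∫ y, (exp ((1 / 2 : ℝ) • H) k ⬝ᵥ φ y) ^ 2 ∂ν := by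
        rw [trace_exp_eq_sum hH, Finset.mul_sum]
        exact Finset.sum_le_sum fun k _ => hlow _
      have := mul_le_mul_of_nonneg_left h hg0
      linarith

variable [TopologicalSpace V] [SecondCountableTopology V] [BorelSpace V]

/-- Induction with `H` arbitrary: by Tonelli the first summand is frozen and absorbed into `H` while
the others are integrated out. -/
lemma lintegral_trace_exp_sub_gramSum_le [Nonempty n] (hs : 0 ≤ s) (hR : 0 < R)
    (hρ : 0 ≤ 1 - (1 - Real.exp (-(s * R))) / R * lam) (hφ : Continuous φ)
    (hbound : ∀ᵐ y ∂ν, 0 < φ y ⬝ᵥ φ y ∧ φ y ⬝ᵥ φ y ≤ R)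
    (hint : ∀ w : n → ℝ, Integrable (fun y => (w ⬝ᵥ φ y) ^ 2) ν)
    (hlow : ∀ w : n → ℝ, lam * (w ⬝ᵥ w) ≤ ∫ y, (w ⬝ᵥ φ y) ^ 2 ∂ν) (N : ℕ)
    {H : Matrix n n ℝ} (hH : H.IsSymm) :
    ∫⁻ y, ENNReal.ofReal (exp (H - s • gramSum φ y)).trace ∂(Measure.pi fun _ : Fin N => ν) ≤
      ENNReal.ofReal ((1 - (1 - Real.exp (-(s * R))) / R * lam) ^ N * (exp H).trace) := by
  set ρ := 1 - (1 - Real.exp (-(s * R))) / R * lam with hρdef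
  induction N generalizing H with
  | zero => simp [gramSum]
  | succ N ih =>
    have hmp := measurePreserving_piFinSuccAbove (fun _ : Fin (N + 1) => ν) 0
    set F : V × (Fin N → V) → ENNReal := fun z => ENNReal.ofReal
      (exp (H - s • vecMulVec (φ z.1) (φ z.1) - s • gramSum φ z.2)).trace with hF
    have hFm : Measurable F := by
      refine ENNReal.measurable_ofReal.comp (Continuous.measurable ?_)
      refine (continuous_matrix_exp.comp ?_).matrix_trace
      exact (continuous_const.sub (((hφ.comp continuous_fst).matrix_vecMulVec
        (hφ.comp continuous_fst)).const_smul s)).sub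
        (((continuous_gramSum hφ).comp continuous_snd).const_smul s)
    have h1 : ∫⁻ y, ENNReal.ofReal (exp (H - s • gramSum φ y)).trace
        ∂(Measure.pi fun _ : Fin (N + 1) => ν) =
        ∫⁻ z, F z ∂(ν.prod (Measure.pi fun _ : Fin N => ν)) := by
      rw [← hmp.lintegral_comp hFm]
      refine lintegral_congr fun y => ?_
      simp only [hF, gramSum_succ, smul_add, sub_sub]
      rfl
    rw [h1, lintegral_prod _ hFm.aemeasurable]
    calc _ ≤ ∫⁻ y, ENNReal.ofReal (ρ ^ N) *
          ENNReal.ofReal (exp (H - s • vecMulVec (φ y) (φ y))).trace ∂ν := by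
          refine lintegral_mono fun y => ?_
          rw [← ENNReal.ofReal_mul (pow_nonneg hρ N)]
          exact ih (hH.sub ((isSymm_vecMulVec_self _).smul s))
      _ ≤ ENNReal.ofReal (ρ ^ N) * ENNReal.ofReal (ρ * (exp H).trace) := by
          rw [lintegral_const_mul' _ _ ENNReal.ofReal_ne_top]
          gcongr
          exact lintegral_trace_exp_sub_vecMulVec_le hs hR hbound hint hlow hH
      _ = _ := by
          rw [← ENNReal.ofReal_mul (pow_nonneg hρ N), pow_succ, mul_assoc]

/-- Lower tail matrix Chernoff bound for sums of independent identically distributed rank-one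
matrices, as a bound on the trace exponential. -/
lemma measure_exp_le_trace_exp_gramSum_le [Nonempty n] (hs : 0 ≤ s) (hR : 0 < R)
    (hρ : 0 ≤ 1 - (1 - Real.exp (-(s * R))) / R * lam) (hφ : Continuous φ)
    (hbound : ∀ᵐ y ∂ν, 0 < φ y ⬝ᵥ φ y ∧ φ y ⬝ᵥ φ y ≤ R)
    (hint : ∀ w : n → ℝ, Integrable (fun y => (w ⬝ᵥ φ y) ^ 2) ν)
    (hlow : ∀ w : n → ℝ, lam * (w ⬝ᵥ w) ≤ ∫ y, (w ⬝ᵥ φ y) ^ 2 ∂ν) (N : ℕ) (c : ℝ) :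
    (Measure.pi fun _ : Fin N => ν)
        {y | Real.exp (-(s * c)) ≤ (exp (-(s • gramSum φ y))).trace} ≤
      ENNReal.ofReal (Fintype.card n * (1 - (1 - Real.exp (-(s * R))) / R * lam) ^ N *
        Real.exp (s * c)) := by
  have h := lintegral_trace_exp_sub_gramSum_le hs hR hρ hφ hbound hint hlow N
    (H := (0 : Matrix n n ℝ)) isSymm_zero
  simp only [zero_sub, exp_zero, trace_one] at h
  have hm : Measurable fun y : Fin N → V => ENNReal.ofReal (exp (-(s • gramSum φ y))).trace :=
    ENNReal.measurable_ofReal.comp (continuous_trace_exp_gramSum hφ s).measurable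
  have hmk := meas_ge_le_lintegral_div (μ := Measure.pi fun _ : Fin N => ν) hm.aemeasurable
    (ε := ENNReal.ofReal (Real.exp (-(s * c)))) (by simp [Real.exp_pos]) ENNReal.ofReal_ne_top
  refine (measure_mono fun y hy => ?_).trans
    (hmk.trans ((ENNReal.div_le_div_right h _).trans (le_of_eq ?_)))
  · exact ENNReal.ofReal_le_ofReal hy
  · rw [← ENNReal.ofReal_div_of_pos (Real.exp_pos _), Real.exp_neg (s * c), div_inv_eq_mul]
    congr 2
    ring

end MatrixChernoff

end RandomEDM

namespace RandomEDM

open Matrix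

noncomputable section

/-- The smallest eigenvalue of the second moment matrix of `(1, p, ‖p‖²)` for `p` uniformly
distributed on `[-1, 1]^d`. -/
def minEig (d : ℕ) : ℝ := (zeta d - √(zeta d ^ 2 - 720 * (d : ℝ))) / 90

/-! ### The constants λ and θ -/

section Constants

variable {d : ℕ}

lemma minEig_pos (hd : 1 ≤ d) : 0 < minEig d := by
  have h : (1 : ℝ) ≤ d := by exact_mod_cast hd
  have hz : 0 < zeta d := by unfold zeta; positivity
  refine div_pos (sub_pos.mpr ?_) (by norm_num)
  rw [Real.sqrt_lt' hz]
  linarith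

lemma minEig_lt_one (hd : 1 ≤ d) : minEig d < 1 := by
  have h : (1 : ℝ) ≤ d := by exact_mod_cast hd
  have : zeta d - 90 < √(zeta d ^ 2 - 720 * (d : ℝ)) := by
    refine Real.lt_sqrt_of_sq_lt ?_
    have : zeta d = 5 * (d : ℝ) ^ 2 + 4 * (d : ℝ) + 45 := rfl
    nlinarith
  rw [minEig, div_lt_one (by norm_num)]
  linarith

lemma minEig_le_third : minEig d ≤ 1 / 3 := by
  have : zeta d - 30 ≤ √(zeta d ^ 2 - 720 * (d : ℝ)) := by
    refine Real.le_sqrt_of_sq_le ?_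
    have : zeta d = 5 * (d : ℝ) ^ 2 + 4 * (d : ℝ) + 45 := rfl
    nlinarith [sq_nonneg ((d : ℝ) - 1)]
  rw [minEig, div_le_div_iff₀ (by norm_num) (by norm_num)]
  linarith

/-- The second-moment matrix is I/3 on the coordinates of p and the block with rows (1, d/3), (d/3,
d²/9 + 4d/45) on (1, ‖p‖²); this is the characteristic equation of the block. -/
lemma minEig_charpoly (hd : 1 ≤ d) :
    (1 - minEig d) * ((d : ℝ) ^ 2 / 9 + 4 * d / 45 - minEig d) = (d : ℝ) ^ 2 / 9 := by
  have h : (1 : ℝ) ≤ d := by exact_mod_cast hd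
  have hz : zeta d = 5 * (d : ℝ) ^ 2 + 4 * (d : ℝ) + 45 := rfl
  have hnn : 0 ≤ zeta d ^ 2 - 720 * (d : ℝ) := by
    have : 30 * (d : ℝ) ≤ zeta d := by rw [hz]; nlinarith [sq_nonneg ((d : ℝ) - 3)]
    nlinarith
  have hs := Real.sq_sqrt hnn
  have h1 : √(zeta d ^ 2 - 720 * (d : ℝ)) = zeta d - 90 * minEig d := by rw [minEig]; ring
  rw [h1, hz] at hs
  linear_combination hs / 8100

lemma minEig_mul_le (hd : 1 ≤ d) {B : ℝ} (hB : 0 ≤ B) (a c : ℝ) :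
    minEig d * (a ^ 2 + c ^ 2 + B) ≤
      (a + d * c / 3) ^ 2 + B / 3 + 4 * d * c ^ 2 / 45 := by
  have h1 : 0 < 1 - minEig d := sub_pos.mpr (minEig_lt_one hd)
  have h2 := mul_le_mul_of_nonneg_right (minEig_le_third (d := d)) hB
  -- By the characteristic equation this form has zero discriminant, so `1 - minEig d` times it is a
  -- perfect square.
  have h3 : 0 ≤ (1 - minEig d) * a ^ 2 + 2 * (d / 3) * a * c +
      ((d : ℝ) ^ 2 / 9 + 4 * d / 45 - minEig d) * c ^ 2 := by
    refine nonneg_of_mul_nonneg_right (b := _) (?_ : 0 ≤ (1 - minEig d) * _) h1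
    have : (1 - minEig d) * ((1 - minEig d) * a ^ 2 + 2 * (d / 3) * a * c +
      ((d : ℝ) ^ 2 / 9 + 4 * d / 45 - minEig d) * c ^ 2) =
        ((1 - minEig d) * a + d * c / 3) ^ 2 := by
      linear_combination c ^ 2 * minEig_charpoly hd
    rw [this]
    positivity
  linarith

lemma theta_eq (d : ℕ) : theta d = (1 + (d : ℝ) + (d : ℝ) ^ 2) / minEig d := by
  rw [theta, minEig, div_div_eq_mul_div]
  ring

lemma theta_pos (hd : 1 ≤ d) : 0 < theta d := by
  rw [theta_eq]
  have := minEig_pos hd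
  positivity

end Constants

/-! ### Moments of the uniform law on [-1, 1] -/

section UniformMoments

/-- The uniform distribution on `[-1, 1]`. -/
def unif : Measure ℝ := ProbabilityTheory.cond volume (Set.Icc (-1) 1)

instance : IsProbabilityMeasure unif :=
  cond_isProbabilityMeasure_of_finite (by simp) (by simp)

lemma ae_unif_mem : ∀ᵐ x ∂unif, x ∈ Set.Icc (-1 : ℝ) 1 := ae_cond_mem measurableSet_Icc

lemma integral_unif (f : ℝ → ℝ) : ∫ x, f x ∂unif = (∫ x in (-1 : ℝ)..1, f x) / 2 := by
  rw [unif, ProbabilityTheory.cond, integral_smul_measure, Real.volume_Icc,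
    intervalIntegral.integral_of_le (by norm_num), integral_Icc_eq_integral_Ioc]
  norm_num
  ring

lemma integral_unif_quadratic (b c : ℝ) : ∫ x, (b * x + c * x ^ 2) ∂unif = c / 3 := by
  rw [integral_unif, intervalIntegral.integral_add]
  · rw [show ∫ x in (-1 : ℝ)..1, b * x = b * ∫ x in (-1 : ℝ)..1, x from
      intervalIntegral.integral_const_mul b _, integral_id]
    simp only [intervalIntegral.integral_const_mul, integral_pow]
    norm_num
    ring
  all_goals exact Continuous.intervalIntegrable (by fun_prop) _ _

lemma integral_unif_quadratic_sq (b c : ℝ) :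
    ∫ x, (b * x + c * x ^ 2) ^ 2 ∂unif = b ^ 2 / 3 + c ^ 2 / 5 := by
  have h : ∀ x : ℝ, (b * x + c * x ^ 2) ^ 2 = b ^ 2 * x ^ 2 + 2 * b * c * x ^ 3 + c ^ 2 * x ^ 4 :=
    fun x => by ring
  simp_rw [h]
  rw [integral_unif, intervalIntegral.integral_add, intervalIntegral.integral_add]
  · simp only [intervalIntegral.integral_const_mul, integral_pow]
    norm_num
    ring
  all_goals exact Continuous.intervalIntegrable (by fun_prop) _ _

lemma memLp_unif_quadratic (b c : ℝ) : MemLp (fun x : ℝ => b * x + c * x ^ 2) 2 unif := by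
  refine MemLp.of_bound (Continuous.aestronglyMeasurable (by fun_prop)) (|b| + |c|) ?_
  filter_upwards [ae_unif_mem] with x hx
  have hx1 : |x| ≤ 1 := abs_le.mpr hx
  rw [Real.norm_eq_abs]
  refine (abs_add_le _ _).trans ?_
  rw [abs_mul, abs_mul, abs_pow]
  have := abs_nonneg b
  have := abs_nonneg c
  gcongr
  · exact mul_le_of_le_one_right ‹_› hx1
  · exact mul_le_of_le_one_right ‹_› (pow_le_one₀ (abs_nonneg _) hx1)

lemma variance_unif_quadratic (b c : ℝ) :
    Var[fun x => b * x + c * x ^ 2; unif] = b ^ 2 / 3 + 4 * c ^ 2 / 45 := by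
  rw [variance_eq_sub (memLp_unif_quadratic b c), integral_unif_quadratic]
  have h := integral_unif_quadratic_sq b c
  simp only [Pi.pow_apply]
  rw [h]
  ring

end UniformMoments

/-! ### The second moment of the feature vector -/

section Features

variable {d : ℕ}

/-- The uniform distribution on `[-1, 1]^d`. -/
def unifCube (d : ℕ) : Measure (Fin d → ℝ) := Measure.pi fun _ => unif

instance : IsProbabilityMeasure (unifCube d) := by unfold unifCube; infer_instance

/-- The vector `(1, ‖p‖², p)`. -/
def feature (p : Fin d → ℝ) : Option (Option (Fin d)) → ℝ
  | none => 1
  | some none => ∑ j, p j ^ 2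
  | some (some j) => p j

lemma continuous_feature : Continuous (feature (d := d)) := by
  refine continuous_pi fun k => ?_
  rcases k with _ | _ | j <;> simp only [feature] <;> fun_prop

lemma dotProduct_option (v w : Option (Option (Fin d)) → ℝ) :
    v ⬝ᵥ w = v none * w none + (v (some none) * w (some none) +
      ∑ j, v (some (some j)) * w (some (some j))) := by
  simp [dotProduct, Fintype.sum_option]

lemma feature_dotProduct_self (p : Fin d → ℝ) :
    feature p ⬝ᵥ feature p = 1 + ((∑ j, p j ^ 2) ^ 2 + ∑ j, p j ^ 2) := by
  rw [dotProduct_option]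
  simp [feature, pow_two]

lemma feature_dotProduct_self_pos (p : Fin d → ℝ) : 0 < feature p ⬝ᵥ feature p := by
  rw [feature_dotProduct_self]
  have : 0 ≤ ∑ j, p j ^ 2 := Finset.sum_nonneg fun j _ => sq_nonneg _
  positivity

lemma feature_dotProduct_self_le {p : Fin d → ℝ} (hp : ∀ j, p j ∈ Set.Icc (-1 : ℝ) 1) :
    feature p ⬝ᵥ feature p ≤ 1 + (d : ℝ) + (d : ℝ) ^ 2 := by
  have h0 : 0 ≤ ∑ j, p j ^ 2 := Finset.sum_nonneg fun j _ => sq_nonneg _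
  have h : ∑ j, p j ^ 2 ≤ (d : ℝ) := by
    have := Finset.sum_le_sum (s := Finset.univ) fun j _ =>
      (sq_le_one_iff_abs_le_one (p j)).mpr (abs_le.mpr (hp j))
    simpa using this
  rw [feature_dotProduct_self]
  have := pow_le_pow_left₀ h0 h 2
  linarith

lemma ae_unifCube_mem : ∀ᵐ p ∂unifCube d, ∀ j, p j ∈ Set.Icc (-1 : ℝ) 1 :=
  ae_all_iff.mpr fun j =>
    (measurePreserving_eval (fun _ : Fin d => unif) j).quasiMeasurePreserving.ae ae_unif_mem

lemma memLp_sum_quadratic (w : Option (Option (Fin d)) → ℝ) :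
    MemLp (fun p : Fin d → ℝ => ∑ j, (w (some (some j)) * p j + w (some none) * p j ^ 2)) 2
      (unifCube d) :=
  memLp_finsetSum _ fun j _ => (memLp_unif_quadratic (w (some (some j))) (w (some none))).comp_measurePreserving
    (measurePreserving_eval (fun _ : Fin d => unif) j)

lemma dotProduct_feature (w : Option (Option (Fin d)) → ℝ) (p : Fin d → ℝ) :
    w ⬝ᵥ feature p =
      ∑ j, (w (some (some j)) * p j + w (some none) * p j ^ 2) + w none := by
  rw [dotProduct_option, Finset.sum_add_distrib, ← Finset.mul_sum]
  simp only [feature]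
  ring

lemma integrable_dotProduct_feature_sq (w : Option (Option (Fin d)) → ℝ) :
    Integrable (fun p => (w ⬝ᵥ feature p) ^ 2) (unifCube d) := by
  simp_rw [dotProduct_feature]
  exact ((memLp_sum_quadratic w).add (memLp_const (w none))).integrable_sq

/-- Squared mean plus variance: the form is a constant plus a sum of functions of independent
coordinates, so the variances add. -/
lemma integral_dotProduct_feature_sq (w : Option (Option (Fin d)) → ℝ) :
    ∫ p, (w ⬝ᵥ feature p) ^ 2 ∂unifCube d =
      (w none + d * w (some none) / 3) ^ 2 + (∑ j, w (some (some j)) ^ 2) / 3 +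
        4 * d * w (some none) ^ 2 / 45 := by
  set Z : (Fin d → ℝ) → ℝ := fun p =>
    ∑ j, (w (some (some j)) * p j + w (some none) * p j ^ 2) with hZ
  have hmem : MemLp Z 2 (unifCube d) := memLp_sum_quadratic w
  have hint : Integrable Z (unifCube d) := hmem.integrable one_le_two
  have hmean : ∫ p, Z p ∂unifCube d = d * w (some none) / 3 := by
    rw [hZ, integral_finsetSum]
    · have h : ∀ j, ∫ p : Fin d → ℝ, (w (some (some j)) * p j + w (some none) * p j ^ 2)
          ∂unifCube d = w (some none) / 3 := fun j => by
        rw [← integral_unif_quadratic (w (some (some j)))]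
        exact integral_comp_eval (μ := fun _ : Fin d => unif)
          (f := fun x => w (some (some j)) * x + w (some none) * x ^ 2)
          (Continuous.aestronglyMeasurable (by fun_prop))
      simp_rw [h]
      simp
      ring
    · exact fun j _ => ((memLp_unif_quadratic (w (some (some j))) (w (some none))).comp_measurePreserving
        (measurePreserving_eval (fun _ : Fin d => unif) j)).integrable one_le_two
  have hvar : Var[Z; unifCube d] =
      ∑ j, (w (some (some j)) ^ 2 / 3 + 4 * w (some none) ^ 2 / 45) := by
    have h := variance_sum_pi (μ := fun _ : Fin d => unif) fun j : Fin d =>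
      memLp_unif_quadratic (w (some (some j))) (w (some none))
    simp_rw [variance_unif_quadratic] at h
    rw [← h, hZ, unifCube]
    congr 1
    ext p
    simp
  rw [variance_eq_sub hmem, hmean, Finset.sum_add_distrib, ← Finset.sum_div] at hvar
  simp only [Pi.pow_apply, Finset.sum_const, Finset.card_univ, Fintype.card_fin, nsmul_eq_mul] at hvar
  have hexp : ∫ p, (w ⬝ᵥ feature p) ^ 2 ∂unifCube d =
      ∫ p, Z p ^ 2 ∂unifCube d + 2 * w none * ∫ p, Z p ∂unifCube d + w none ^ 2 := by
    have h : ∀ p, (w ⬝ᵥ feature p) ^ 2 = Z p ^ 2 + 2 * w none * Z p + w none ^ 2 := fun p => by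
      rw [dotProduct_feature]; ring
    simp_rw [h]
    have h1 : Integrable (fun p => Z p ^ 2 + 2 * w none * Z p) (unifCube d) :=
      hmem.integrable_sq.add (hint.const_mul _)
    rw [integral_add h1 (integrable_const _),
      integral_add hmem.integrable_sq (hint.const_mul _), integral_const_mul]
    simp
  rw [hexp, hmean]
  linarith

lemma minEig_mul_dotProduct_self_le (hd : 1 ≤ d) (w : Option (Option (Fin d)) → ℝ) :
    minEig d * (w ⬝ᵥ w) ≤ ∫ p, (w ⬝ᵥ feature p) ^ 2 ∂unifCube d := by
  rw [integral_dotProduct_feature_sq, dotProduct_option]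
  have h := minEig_mul_le hd (B := ∑ j, w (some (some j)) ^ 2)
    (Finset.sum_nonneg fun j _ => sq_nonneg _)
    (w none) (w (some none))
  refine le_trans (le_of_eq ?_) h
  simp only [pow_two]
  ring

end Features

end

end RandomEDM

namespace RandomEDM

open Matrix

noncomputable section

/-! ### Compact singular value decompositions -/

section SVD

variable {N : ℕ}

/-- Keep the eigenvectors with nonzero eigenvalue, take absolute values as singular values, and move
the signs into the right factor. -/
lemma exists_isCompactSVD_of_isSymm {M : Matrix (Fin N) (Fin N) ℝ} (hM : M.IsSymm) :
    ∃ U σ V, IsCompactSVD M U σ V := by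
  have hH : M.IsHermitian := by rw [IsHermitian, conjTranspose_eq_transpose_of_trivial]; exact hM
  set W : Matrix (Fin N) (Fin N) ℝ := (hH.eigenvectorUnitary : Matrix (Fin N) (Fin N) ℝ) with hW
  have hW1 : Wᵀ * W = 1 := by
    have := Unitary.coe_star_mul_self hH.eigenvectorUnitary
    rwa [star_eq_conjTranspose, conjTranspose_eq_transpose_of_trivial] at this
  have hspec : M = W * diagonal hH.eigenvalues * Wᵀ := by
    have := hH.spectral_theorem
    rw [Unitary.conjStarAlgAut_apply, star_eq_conjTranspose,
      conjTranspose_eq_transpose_of_trivial] at this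
    simpa using this
  have hcard : Fintype.card {i // hH.eigenvalues i ≠ 0} = M.rank :=
    hH.rank_eq_card_non_zero_eigs.symm
  let e : Fin M.rank ≃ {i // hH.eigenvalues i ≠ 0} :=
    (finCongr hcard.symm).trans (Fintype.equivFin _).symm
  set ev : Fin M.rank → ℝ := fun k => hH.eigenvalues (e k) with hev
  have hev0 : ∀ k, ev k ≠ 0 := fun k => (e k).2
  set U : Matrix (Fin N) (Fin M.rank) ℝ := W.submatrix id fun k => (e k : Fin N) with hU
  set D : Matrix (Fin M.rank) (Fin M.rank) ℝ := diagonal fun k => SignType.sign (ev k) with hD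
  have hUU : Uᵀ * U = 1 := by
    have h : Uᵀ * U = (Wᵀ * W).submatrix (fun k => (e k : Fin N)) fun k => (e k : Fin N) := rfl
    rw [h, hW1]
    exact submatrix_one _ (Subtype.val_injective.comp e.injective)
  have hDD : D * D = 1 := by
    rw [hD, diagonal_mul_diagonal, ← diagonal_one]
    congr 1
    funext k
    rcases (hev0 k).lt_or_gt with h | h <;> simp [h]
  refine ⟨U, fun k => |ev k|, U * D, hUU, ?_, fun k => abs_pos.mpr (hev0 k), ?_⟩
  · rw [transpose_mul, hD, diagonal_transpose, ← hD, Matrix.mul_assoc, ← Matrix.mul_assoc Uᵀ, hUU,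
      Matrix.one_mul, hDD]
  · have h1 : diagonal (fun k => |ev k|) * D = diagonal ev := by
      rw [hD, diagonal_mul_diagonal]
      congr 1
      funext k
      exact abs_mul_sign _
    rw [transpose_mul, hD, diagonal_transpose, ← hD, ← Matrix.mul_assoc, Matrix.mul_assoc U, h1]
    conv_lhs => rw [hspec]
    ext i j
    rw [mul_apply, mul_apply]
    simp only [mul_diagonal, transpose_apply, hU, submatrix_apply, id]
    rw [← Equiv.sum_comp e.symm]
    simp only [hev, Equiv.apply_symm_apply]
    rw [← Fintype.sum_subtype_add_sum_subtype (fun k => hH.eigenvalues k ≠ 0)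
      (fun k => W i k * hH.eigenvalues k * W j k)]
    rw [Finset.sum_eq_zero (s := (Finset.univ : Finset {k // ¬ hH.eigenvalues k ≠ 0})), add_zero]
    rintro ⟨k, hk⟩ -
    simp [not_not.mp hk]

lemma IsCompactSVD.eq_left {M : Matrix (Fin N) (Fin N) ℝ} {U σ V} (h : IsCompactSVD M U σ V) :
    U = M * (V * diagonal fun k => (σ k)⁻¹) := by
  have h1 : diagonal σ * diagonal (fun k => (σ k)⁻¹) = 1 := by
    rw [diagonal_mul_diagonal, ← diagonal_one]
    congr 1
    funext k
    exact mul_inv_cancel₀ (h.pos k).ne'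
  have h2 : M * V = U * diagonal σ := by
    calc M * V = U * diagonal σ * Vᵀ * V := congrArg (· * V) h.eq_mul
      _ = _ := by rw [Matrix.mul_assoc _ Vᵀ V, h.orthonormal_right, Matrix.mul_one]
  rw [← Matrix.mul_assoc, h2, Matrix.mul_assoc, h1, Matrix.mul_one]

lemma IsCompactSVD.eq_right {M : Matrix (Fin N) (Fin N) ℝ} {U σ V} (h : IsCompactSVD M U σ V) :
    V = Mᵀ * (U * diagonal fun k => (σ k)⁻¹) := by
  have h1 : diagonal σ * diagonal (fun k => (σ k)⁻¹) = 1 := by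
    rw [diagonal_mul_diagonal, ← diagonal_one]
    congr 1
    funext k
    exact mul_inv_cancel₀ (h.pos k).ne'
  have h2 : Mᵀ * U = V * diagonal σ := by
    calc Mᵀ * U = (U * diagonal σ * Vᵀ)ᵀ * U := congrArg (fun A => Aᵀ * U) h.eq_mul
      _ = _ := by
        rw [transpose_mul, transpose_mul, transpose_transpose, diagonal_transpose, Matrix.mul_assoc,
          Matrix.mul_assoc, h.orthonormal_left, Matrix.mul_one]
  rw [← Matrix.mul_assoc, h2, Matrix.mul_assoc, h1, Matrix.mul_one]

end SVD

/-! ### Column and row spaces -/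

section ColumnSpace

variable {N : ℕ}

lemma finrank_colSpace (M : Matrix (Fin N) (Fin N) ℝ) :
    Module.finrank ℝ (colSpace M) = M.rank := by
  have h : colSpace M = (Submodule.span ℝ (Set.range M.col)).map
      ((WithLp.linearEquiv 2 ℝ (Fin N → ℝ)).symm : (Fin N → ℝ) →ₗ[ℝ] EuclideanSpace ℝ (Fin N)) := by
    rw [Submodule.map_span, ← Set.range_comp]
    rfl
  rw [h, LinearEquiv.finrank_map_eq, rank_eq_finrank_span_cols]

lemma rowSpace_eq_colSpace {M : Matrix (Fin N) (Fin N) ℝ} (hM : M.IsSymm) :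
    rowSpace M = colSpace M := by
  conv_rhs => rw [← hM.eq]
  rfl

lemma exists_mulVec_of_mem_colSpace {ι : Type*} [Fintype ι] (X : Matrix (Fin N) ι ℝ)
    (Y : Matrix ι (Fin N) ℝ) {q : EuclideanSpace ℝ (Fin N)} (hq : q ∈ colSpace (X * Y)) :
    ∃ a, WithLp.ofLp q = X *ᵥ a := by
  induction hq using Submodule.span_induction with
  | mem q hq =>
    obtain ⟨j, rfl⟩ := hq
    exact ⟨fun k => Y k j, rfl⟩
  | zero => exact ⟨0, by simp⟩
  | add q r _ _ hq hr =>
    obtain ⟨a, ha⟩ := hq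
    obtain ⟨b, hb⟩ := hr
    exact ⟨a + b, by rw [mulVec_add, ← ha, ← hb]; rfl⟩
  | smul c q _ hq =>
    obtain ⟨a, ha⟩ := hq
    exact ⟨c • a, by rw [mulVec_smul, ← ha]; rfl⟩

end ColumnSpace

/-! ### Leverage scores from a lower bound on XᵀX -/

section Leverage

variable {N : ℕ} {ι : Type*} [Fintype ι]

lemma dotProduct_sq_le (v w : ι → ℝ) : (v ⬝ᵥ w) ^ 2 ≤ (v ⬝ᵥ v) * (w ⬝ᵥ w) := by
  have := Finset.sum_mul_sq_le_sq_mul_sq Finset.univ v w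
  simpa only [dotProduct, pow_two] using this

lemma apply_le_of_eq_dotProduct_self {X : Matrix (Fin N) ι ℝ} {R c : ℝ} (hc : 0 < c)
    (hR : ∀ i, X i ⬝ᵥ X i ≤ R) (hX : ∀ v, c * (v ⬝ᵥ v) ≤ (X *ᵥ v) ⬝ᵥ (X *ᵥ v))
    (a : ι → ℝ) (i : Fin N) (ha : (X *ᵥ a) i = (X *ᵥ a) ⬝ᵥ (X *ᵥ a)) : (X *ᵥ a) i ≤ R / c := by
  have h1 : ((X *ᵥ a) i) ^ 2 ≤ R * (a ⬝ᵥ a) :=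
    (dotProduct_sq_le (X i) a).trans (mul_le_mul_of_nonneg_right (hR i)
      (Finset.sum_nonneg fun j _ => mul_self_nonneg _))
  have h2 : c * (a ⬝ᵥ a) ≤ (X *ᵥ a) i := ha ▸ hX a
  have hR0 : 0 ≤ R := le_trans (Finset.sum_nonneg fun j _ => mul_self_nonneg _) (hR i)
  rw [le_div_iff₀ hc]
  rcases le_or_gt ((X *ᵥ a) i) 0 with h | h
  · nlinarith
  · refine le_of_mul_le_mul_right ?_ h
    nlinarith [mul_le_mul_of_nonneg_left h2 hR0, mul_le_mul_of_nonneg_left h1 hc.le]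

lemma norm_starProjection_single_sq_le {X : Matrix (Fin N) ι ℝ} {R c : ℝ} (hc : 0 < c)
    (hR : ∀ i, X i ⬝ᵥ X i ≤ R) (hX : ∀ v, c * (v ⬝ᵥ v) ≤ (X *ᵥ v) ⬝ᵥ (X *ᵥ v))
    (Y : Matrix ι (Fin N) ℝ) (i : Fin N) :
    ‖(colSpace (X * Y)).starProjection (EuclideanSpace.single i (1 : ℝ))‖ ^ 2 ≤ R / c := by
  set q := (colSpace (X * Y)).starProjection (EuclideanSpace.single i (1 : ℝ)) with hq
  obtain ⟨a, ha⟩ := exists_mulVec_of_mem_colSpace X Y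
    (Submodule.starProjection_apply_mem (colSpace (X * Y)) (EuclideanSpace.single i (1 : ℝ)))
  rw [← hq] at ha
  have h1 : ‖q‖ ^ 2 = q i := by
    have h := Submodule.re_inner_starProjection_eq_normSq (𝕜 := ℝ) (K := colSpace (X * Y))
      (EuclideanSpace.single i (1 : ℝ))
    rw [← hq, EuclideanSpace.inner_single_right] at h
    simpa using h.symm
  have h2 : ‖q‖ ^ 2 = (X *ᵥ a) ⬝ᵥ (X *ᵥ a) := by
    rw [EuclideanSpace.real_norm_sq_eq, ← ha]
    simp [dotProduct, pow_two]
  have h3 : q i = (X *ᵥ a) i := congrFun ha i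
  rw [h1, h3]
  exact apply_le_of_eq_dotProduct_self hc hR hX a i (by rw [← h3, ← h1, h2])

/-- The vector `U *ᵥ U i` is U Uᵀ eᵢ, the projection of eᵢ onto the span of the columns of `U`; its
i-th entry and its squared norm both equal `U i ⬝ᵥ U i`. -/
lemma row_dotProduct_self_le {X : Matrix (Fin N) ι ℝ} {R c : ℝ} (hc : 0 < c)
    (hR : ∀ i, X i ⬝ᵥ X i ≤ R) (hX : ∀ v, c * (v ⬝ᵥ v) ≤ (X *ᵥ v) ⬝ᵥ (X *ᵥ v)) {κ : Type*}
    [Fintype κ] [DecidableEq κ] {U : Matrix (Fin N) κ ℝ} (hU : Uᵀ * U = 1) {Y : Matrix ι κ ℝ}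
    (hUX : U = X * Y) (i : Fin N) : U i ⬝ᵥ U i ≤ R / c := by
  have h1 : X *ᵥ (Y *ᵥ U i) = U *ᵥ U i := by rw [mulVec_mulVec, ← hUX]
  have h2 : (U *ᵥ U i) i = U i ⬝ᵥ U i := rfl
  have h3 : (U *ᵥ U i) ⬝ᵥ (U *ᵥ U i) = U i ⬝ᵥ U i := by
    rw [dotProduct_mulVec, vecMul_mulVec, hU, vecMul_one]
  have h := apply_le_of_eq_dotProduct_self hc hR hX (Y *ᵥ U i) i (by rw [h1, h2, h3])
  rwa [h1] at h

end Leverage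

end

end RandomEDM

namespace RandomEDM

open Matrix NormedSpace

noncomputable section

/-! ### Factorization of the distance matrix, and A0 and A1 from it -/

section Factorization

variable {N d : ℕ}

/-- The matrix whose rows are the vectors `(1, ‖p i‖², p i)`. -/
def featureMatrix (p : Fin N → Fin d → ℝ) : Matrix (Fin N) (Option (Option (Fin d))) ℝ :=
  of fun i => feature (p i)

/-- The matrix of the bilinear form taking the features of two points to their squared distance. -/
def coupling (d : ℕ) (a : ℝ) : Matrix (Option (Option (Fin d))) (Option (Option (Fin d))) ℝ :=
  of fun
    | none, some none => 1
    | some none, none => 1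
    | some (some j), some (some k) => if j = k then a else 0
    | _, _ => 0

lemma coupling_mul_coupling (d : ℕ) {a b : ℝ} (h : a * b = 1) :
    coupling d a * coupling d b = 1 := by
  ext j k
  rcases j with _ | _ | j <;> rcases k with _ | _ | k <;>
    simp [mul_apply, Fintype.sum_option, coupling, one_apply, h]

lemma edm_eq_mul (p : Fin N → Fin d → ℝ) :
    edm (fun i => WithLp.toLp 2 (p i)) =
      featureMatrix p * (coupling d (-2) * (featureMatrix p)ᵀ) := by
  ext i j
  simp only [edm, of_apply, EuclideanSpace.real_norm_sq_eq, mul_apply, Fintype.sum_option,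
    featureMatrix, coupling, transpose_apply, feature]
  simp only [PiLp.sub_apply, zero_mul, mul_one, one_mul, zero_add, add_zero,
    Finset.sum_const_zero, ite_mul, Finset.sum_ite_eq, Finset.mem_univ, if_true,
    ← Finset.sum_add_distrib]
  exact Finset.sum_congr rfl fun k _ => by ring

lemma isSymm_edm (p : Fin N → EuclideanSpace ℝ (Fin d)) : (edm p).IsSymm := by
  ext i j
  simp [edm, norm_sub_rev]

lemma rank_edm_le (p : Fin N → Fin d → ℝ) : (edm fun i => WithLp.toLp 2 (p i)).rank ≤ d + 2 := by
  rw [edm_eq_mul]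
  refine (rank_mul_le_left _ _).trans ((rank_le_card_width _).trans ?_)
  simp

lemma dotProduct_gramSum_mulVec (p : Fin N → Fin d → ℝ) (v : Option (Option (Fin d)) → ℝ) :
    v ⬝ᵥ (gramSum feature p *ᵥ v) = (featureMatrix p *ᵥ v) ⬝ᵥ (featureMatrix p *ᵥ v) := by
  have h : gramSum feature p = (featureMatrix p)ᵀ * featureMatrix p := by
    ext j k
    simp [gramSum, Matrix.sum_apply, mul_apply, vecMulVec_apply, featureMatrix]
  rw [h, ← mulVec_mulVec, dotProduct_mulVec, vecMul_transpose]

/-- The product XᵀΔX = (XᵀX) B (XᵀX) is invertible of size d + 2, which bounds the rank of Δ from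
below. -/
lemma rank_edm_eq {p : Fin N → Fin d → ℝ} {c : ℝ} (hc : 0 < c)
    (hX : ∀ v, c * (v ⬝ᵥ v) ≤ (featureMatrix p *ᵥ v) ⬝ᵥ (featureMatrix p *ᵥ v)) :
    (edm fun i => WithLp.toLp 2 (p i)).rank = d + 2 := by
  refine le_antisymm (rank_edm_le p) ?_
  set X := featureMatrix p with hXdef
  have hinj : Function.Injective X.mulVec := by
    refine (injective_iff_map_eq_zero X.mulVecLin).mpr fun v hv => ?_
    have h := hX v
    rw [show X *ᵥ v = 0 from hv, dotProduct_zero] at h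
    have h0 : 0 ≤ v ⬝ᵥ v := Finset.sum_nonneg fun j _ => mul_self_nonneg _
    exact dotProduct_self_eq_zero.mp (le_antisymm (nonpos_of_mul_nonpos_right h hc) h0)
  have hS : IsUnit (Xᵀ * X) := by
    have := (PosDef.conjTranspose_mul_self X hinj).isUnit
    rwa [conjTranspose_eq_transpose_of_trivial] at this
  have hB : IsUnit (coupling d (-2)) :=
    ⟨⟨coupling d (-2), coupling d (-(1 / 2)), coupling_mul_coupling d (by norm_num),
      coupling_mul_coupling d (by norm_num)⟩, rfl⟩
  have hrank : (Xᵀ * (edm fun i => WithLp.toLp 2 (p i)) * X).rank = d + 2 := by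
    have h : Xᵀ * (edm fun i => WithLp.toLp 2 (p i)) * X =
        (Xᵀ * X) * coupling d (-2) * (Xᵀ * X) := by
      rw [edm_eq_mul, ← hXdef]
      simp only [Matrix.mul_assoc]
    rw [h, rank_of_isUnit _ ((hS.mul hB).mul hS)]
    simp
  rw [← hrank]
  exact (rank_mul_le_left _ _).trans (rank_mul_le_right _ _)

lemma assumptions_edm {p : Fin N → Fin d → ℝ} {R c τ : ℝ} (hN : 0 < N) (hc : 0 < c) (hτ : 0 < τ)
    (hR : ∀ i, feature (p i) ⬝ᵥ feature (p i) ≤ R)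
    (hX : ∀ v, c * (v ⬝ᵥ v) ≤ (featureMatrix p *ᵥ v) ⬝ᵥ (featureMatrix p *ᵥ v))
    (hRc : R / c = τ / N) :
    AssumptionA0 (edm fun i => WithLp.toLp 2 (p i)) (τ / ((d : ℝ) + 2)) ∧
      AssumptionA1 (edm fun i => WithLp.toLp 2 (p i)) (τ / √((d : ℝ) + 2)) := by
  set M := edm fun i => WithLp.toLp 2 (p i) with hM
  have hsymm : M.IsSymm := isSymm_edm _
  have hrank : M.rank = d + 2 := rank_edm_eq hc hX
  have hfac : M = featureMatrix p * (coupling d (-2) * (featureMatrix p)ᵀ) := edm_eq_mul p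
  have hN' : (0 : ℝ) < N := by exact_mod_cast hN
  have hd' : (0 : ℝ) < (d : ℝ) + 2 := by positivity
  refine ⟨⟨by positivity, ?_⟩, by positivity, exists_isCompactSVD_of_isSymm hsymm, ?_⟩
  · rw [rowSpace_eq_colSpace hsymm, max_self, coherence, finrank_colSpace, hrank]
    have hsup : ⨆ i : Fin N, ‖(colSpace M).starProjection
        (EuclideanSpace.single i (1 : ℝ))‖ ^ 2 ≤ τ / N := by
      refine Real.iSup_le (fun i => ?_) (by positivity)
      rw [← hRc, hfac]
      exact norm_starProjection_single_sq_le hc hR hX _ i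
    refine (mul_le_mul_of_nonneg_left hsup (by positivity)).trans (le_of_eq ?_)
    push_cast
    field_simp
  · intro U σ V hUV i j
    have hU : U i ⬝ᵥ U i ≤ τ / N := by
      rw [← hRc]
      refine row_dotProduct_self_le (X := featureMatrix p) hc hR hX hUV.orthonormal_left
        (Y := coupling d (-2) * (featureMatrix p)ᵀ * (V * diagonal fun k => (σ k)⁻¹)) ?_ i
      rw [← Matrix.mul_assoc, ← hfac]
      exact hUV.eq_left
    have hV : V j ⬝ᵥ V j ≤ τ / N := by
      rw [← hRc]
      refine row_dotProduct_self_le (X := featureMatrix p) hc hR hX hUV.orthonormal_right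
        (Y := coupling d (-2) * (featureMatrix p)ᵀ * (U * diagonal fun k => (σ k)⁻¹)) ?_ j
      rw [← Matrix.mul_assoc, ← hfac]
      exact hUV.eq_right.trans (congrArg (· * _) hsymm.eq)
    have hbound : |(U * Vᵀ) i j| ≤ τ / N := by
      refine abs_le_of_sq_le_sq ?_ (by positivity)
      calc ((U * Vᵀ) i j) ^ 2 = (U i ⬝ᵥ V j) ^ 2 := rfl
        _ ≤ (U i ⬝ᵥ U i) * (V j ⬝ᵥ V j) := dotProduct_sq_le _ _
        _ ≤ (τ / N) * (τ / N) := mul_le_mul hU hV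
            (Finset.sum_nonneg fun k _ => mul_self_nonneg _) (by positivity)
        _ = _ := (pow_two _).symm
    refine hbound.trans (le_of_eq ?_)
    rw [hrank, Real.sqrt_div (by positivity), Real.sqrt_mul_self hN'.le]
    push_cast
    have := (Real.sqrt_pos.mpr hd').ne'
    field_simp

end Factorization

/-! ### The joint law of the points -/

section Law

variable {Ω : Type*} [MeasurableSpace Ω] {P : Measure Ω} [IsProbabilityMeasure P] {N d : ℕ}

lemma map_eq_pi_unifCube {x : Fin N → Fin d → Ω → ℝ} (hx_meas : ∀ i j, Measurable (x i j))
    (hx_indep : iIndepFun (fun q : Fin N × Fin d => x q.1 q.2) P)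
    (hx_unif : ∀ i j, pdf.IsUniform (x i j) (Set.Icc (-1 : ℝ) 1) P volume) :
    P.map (fun ω i j => x i j ω) = Measure.pi fun _ : Fin N => unifCube d := by
  have h1 := (iIndepFun_iff_map_fun_eq_pi_map fun q : Fin N × Fin d =>
    (hx_meas q.1 q.2).aemeasurable).mp hx_indep
  have h2 : ∀ i j, P.map (x i j) = unif := hx_unif
  simp_rw [h2] at h1
  have h3 : (fun ω i j => x i j ω) = MeasurableEquiv.curry (Fin N) (Fin d) ℝ ∘
      fun ω (q : Fin N × Fin d) => x q.1 q.2 ω := rfl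
  have h5 : Measurable fun ω (q : Fin N × Fin d) => x q.1 q.2 ω :=
    measurable_pi_lambda _ fun q => hx_meas q.1 q.2
  rw [h3, ← Measure.map_map (MeasurableEquiv.measurable _) h5, h1, ← Measure.infinitePi_eq_pi]
  have h4 := Measure.infinitePi_map_curry (fun (_ : Fin N) (_ : Fin d) => unif)
  rw [h4]
  simp only [Measure.infinitePi_eq_pi]
  rfl

end Law

/-! ### The scalar tail estimate -/

section Numerics

/-- This is x ≤ sinh x at x = log(1/t), multiplied by t. -/
lemma sq_one_sub_div_two_le {t : ℝ} (ht : 0 < t) (ht1 : t < 1) :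
    (1 - t) ^ 2 / 2 ≤ 1 - t + t * Real.log t := by
  have h0 : 0 ≤ Real.log t⁻¹ := Real.log_nonneg ((one_le_inv₀ ht).mpr ht1.le)
  have h := Real.self_le_sinh_iff.mpr h0
  rw [Real.sinh_log (inv_pos.mpr ht), Real.log_inv, inv_inv] at h
  have h2 := mul_le_mul_of_nonneg_left h ht.le
  have h3 : t * ((t⁻¹ - t) / 2) = (1 - t ^ 2) / 2 := by field_simp
  rw [h3] at h2
  nlinarith

lemma chernoff_tail_le {N : ℕ} {D θ t γ : ℝ} (hD : 0 < D) (hθ : 0 < θ) (ht : 0 < t) (ht1 : t < 1)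
    (hγ : 0 < γ) (hρ : 0 ≤ 1 - (1 - t) / θ)
    (hN : 2 * θ * (Real.log D - Real.log γ) / (1 - t) ^ 2 ≤ N) :
    D * (1 - (1 - t) / θ) ^ N * Real.exp (-Real.log t * (t * N / θ)) ≤ γ := by
  have h1t : 0 < 1 - t := sub_pos.mpr ht1
  have h1 : 1 - (1 - t) / θ ≤ Real.exp (-((1 - t) / θ)) := by
    have := Real.add_one_le_exp (-((1 - t) / θ))
    linarith
  have h2 : (1 - (1 - t) / θ) ^ N ≤ Real.exp (N * -((1 - t) / θ)) := by
    rw [Real.exp_nat_mul]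
    exact pow_le_pow_left₀ hρ h1 N
  have h3 : Real.log D - Real.log γ ≤ N / θ * ((1 - t) ^ 2 / 2) := by
    rw [div_le_iff₀ (by positivity)] at hN
    rw [div_mul_div_comm, le_div_iff₀ (by positivity)]
    linarith
  have h4 : N / θ * ((1 - t) ^ 2 / 2) ≤ N / θ * (1 - t + t * Real.log t) :=
    mul_le_mul_of_nonneg_left (sq_one_sub_div_two_le ht ht1) (by positivity)
  calc D * (1 - (1 - t) / θ) ^ N * Real.exp (-Real.log t * (t * N / θ))
      ≤ D * Real.exp (N * -((1 - t) / θ)) * Real.exp (-Real.log t * (t * N / θ)) := by gcongr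
    _ = Real.exp (Real.log D - N / θ * (1 - t + t * Real.log t)) := by
      nth_rw 1 [← Real.exp_log hD]
      rw [← Real.exp_add, ← Real.exp_add]
      congr 1
      field_simp
      ring
    _ ≤ Real.exp (Real.log γ) := Real.exp_le_exp.mpr (by linarith)
    _ = γ := Real.exp_log hγ

end Numerics

/-! ### The good event -/

lemma exists_measurableSet_assumptions {Ω : Type*} [MeasurableSpace Ω] (P : Measure Ω)
    [IsProbabilityMeasure P] (N d : ℕ) (hd : 1 ≤ d)
    (x : Fin N → Fin d → Ω → ℝ)
    (hx_meas : ∀ i j, Measurable (x i j))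
    (hx_indep : iIndepFun (fun q : Fin N × Fin d => x q.1 q.2) P)
    (hx_unif : ∀ i j, pdf.IsUniform (x i j) (Set.Icc (-1 : ℝ) 1) P volume)
    (t γ : ℝ) (ht_pos : 0 < t) (ht_lt : t < 1) (hγ_pos : 0 < γ) (hγ_le : γ ≤ 1)
    (hN : (N : ℝ) ≥
      2 * theta d * (Real.log ((d : ℝ) + 2) - Real.log γ) / (1 - t) ^ 2) :
    ∃ E : Set Ω, MeasurableSet E ∧ 1 - γ ≤ P.real E ∧ ∀ ω ∈ E,
      AssumptionA0 (edm fun i => WithLp.toLp 2 fun j => x i j ω)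
        (theta d / (t * ((d : ℝ) + 2))) ∧
      AssumptionA1 (edm fun i => WithLp.toLp 2 fun j => x i j ω)
        (theta d / (t * √((d : ℝ) + 2))) := by
  have hθ := theta_pos hd
  have hlam := minEig_pos hd
  have h1t : 0 < 1 - t := sub_pos.mpr ht_lt
  set R : ℝ := 1 + (d : ℝ) + (d : ℝ) ^ 2 with hR
  have hRpos : 0 < R := by positivity
  have hR1 : 1 ≤ R := by rw [hR, add_assoc]; exact le_add_of_nonneg_right (by positivity)
  have hθR : theta d = R / minEig d := theta_eq d
  have hN0 : (0 : ℝ) < N := by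
    refine lt_of_lt_of_le ?_ hN
    have h1 : 0 < Real.log ((d : ℝ) + 2) := Real.log_pos (by linarith [(Nat.cast_nonneg d : (0 : ℝ) ≤ d)])
    have h2 : Real.log γ ≤ 0 := Real.log_nonpos hγ_pos.le hγ_le
    have h3 : 0 < Real.log ((d : ℝ) + 2) - Real.log γ := by linarith
    positivity
  -- This `s`, for which e^(-sR) = t, minimizes -N(1 - e^(-sR))λ/R + s·tNλ, the exponent of the tail
  -- bound after 1 - x ≤ e^(-x).
  set s : ℝ := -Real.log t / R with hs
  have hspos : 0 < s := div_pos (neg_pos.mpr (Real.log_neg ht_pos ht_lt)) hRpos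
  have hsR : Real.exp (-(s * R)) = t := by
    rw [hs, div_mul_cancel₀ _ hRpos.ne', neg_neg, Real.exp_log ht_pos]
  set c : ℝ := t * N * minEig d with hc
  have hcpos : 0 < c := by positivity
  -- The cube condition has full measure; it is included because the bound ‖φ‖² ≤ R must hold at
  -- every point of the event.
  set G : Set (Fin N → Fin d → ℝ) :=
    {y | (NormedSpace.exp (-(s • gramSum feature y))).trace < Real.exp (-(s * c))} ∩
      {y | ∀ i j, y i j ∈ Set.Icc (-1 : ℝ) 1} with hG
  have hGm : MeasurableSet G := by
    refine MeasurableSet.inter ?_ ?_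
    · exact measurableSet_lt (continuous_trace_exp_gramSum continuous_feature s).measurable
        measurable_const
    · simp only [Set.ofPred_forall]
      exact MeasurableSet.iInter fun i => MeasurableSet.iInter fun j =>
        measurableSet_Icc.preimage ((measurable_pi_apply j).comp (measurable_pi_apply i))
  set Y : Ω → Fin N → Fin d → ℝ := fun ω i j => x i j ω with hY
  have hYm : Measurable Y :=
    measurable_pi_lambda _ fun i => measurable_pi_lambda _ fun j => hx_meas i j
  refine ⟨Y ⁻¹' G, hYm hGm, ?_, fun ω hω => ?_⟩
  · have hρ : 1 - (1 - Real.exp (-(s * R))) / R * minEig d = 1 - (1 - t) / theta d := by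
      rw [hsR, hθR]; field_simp
    have hρ0 : 0 ≤ 1 - (1 - t) / theta d := by
      rw [← hρ, hsR, sub_nonneg]
      have h1 : (1 - t) / R ≤ 1 := (div_le_one hRpos).mpr (by linarith)
      exact mul_le_one₀ h1 hlam.le (minEig_lt_one hd).le
    have htail := measure_exp_le_trace_exp_gramSum_le (ν := unifCube d) (φ := feature) (R := R)
      (lam := minEig d) hspos.le hRpos (hρ ▸ hρ0) continuous_feature
      (ae_unifCube_mem.mono fun p hp =>
        ⟨feature_dotProduct_self_pos p, feature_dotProduct_self_le hp⟩)
      integrable_dotProduct_feature_sq (minEig_mul_dotProduct_self_le hd) N c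
    have hsc : s * c = -Real.log t * (t * N / theta d) := by
      rw [hs, hc, hθR]; field_simp
    have hcard : (Fintype.card (Option (Option (Fin d))) : ℝ) = (d : ℝ) + 2 := by
      simp; ring
    have hmain : (Measure.pi fun _ : Fin N => unifCube d) Gᶜ ≤ ENNReal.ofReal γ := by
      have hcube : (Measure.pi fun _ : Fin N => unifCube d)
          {y | ∀ i j, y i j ∈ Set.Icc (-1 : ℝ) 1}ᶜ = 0 := by
        have : ∀ᵐ y ∂(Measure.pi fun _ : Fin N => unifCube d),
            ∀ i j, y i j ∈ Set.Icc (-1 : ℝ) 1 := ae_all_iff.mpr fun i =>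
          (measurePreserving_eval (fun _ : Fin N => unifCube d) i).quasiMeasurePreserving.ae
            ae_unifCube_mem
        exact this
      rw [hG, Set.compl_inter]
      refine (measure_union_le _ _).trans ?_
      rw [hcube, add_zero]
      refine le_trans (le_of_eq ?_) (htail.trans (ENNReal.ofReal_le_ofReal ?_))
      · congr 1
        ext y
        simp
      · rw [hρ, hsc, hcard]
        exact chernoff_tail_le (by positivity) hθ ht_pos ht_lt hγ_pos hρ0 hN
    rw [← map_eq_pi_unifCube hx_meas hx_indep hx_unif, Measure.map_apply hYm hGm.compl,
      Set.preimage_compl] at hmain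
    have h := ENNReal.toReal_mono ENNReal.ofReal_ne_top hmain
    rw [ENNReal.toReal_ofReal hγ_pos.le] at h
    change P.real (Y ⁻¹' G)ᶜ ≤ γ at h
    rw [probReal_compl_eq_one_sub (hYm hGm)] at h
    linarith
  · obtain ⟨hω1, hω2⟩ := hω
    have hX : ∀ v, c * (v ⬝ᵥ v) ≤
        (featureMatrix (Y ω) *ᵥ v) ⬝ᵥ (featureMatrix (Y ω) *ᵥ v) := fun v => by
      have h := dotProduct_mulVec_le_of_trace_exp_lt
        ((isSymm_gramSum feature (Y ω)).smul s).neg hω1 v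
      rw [neg_mulVec, smul_mulVec, dotProduct_neg, dotProduct_smul, smul_eq_mul, neg_mul,
        neg_le_neg_iff, mul_assoc] at h
      rw [← dotProduct_gramSum_mulVec]
      exact le_of_mul_le_mul_left h hspos
    have hN' : 0 < N := by exact_mod_cast hN0
    have h := assumptions_edm (p := Y ω) (R := R) (τ := theta d / t) hN' hcpos (by positivity)
      (fun i => feature_dotProduct_self_le (hω2 i)) hX (by rw [hc, hθR]; field_simp)
    rw [div_div, div_div] at h
    exact h

end

end RandomEDM

theorem corollary1 {Ω : Type*} [MeasurableSpace Ω] (P : Measure Ω) [IsProbabilityMeasure P]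
    (N d : ℕ) (hd : 1 ≤ d)
    (x : Fin N → Fin d → Ω → ℝ)
    (hx_meas : ∀ i j, Measurable (x i j))
    (hx_indep : iIndepFun (fun q : Fin N × Fin d => x q.1 q.2) P)
    (hx_unif : ∀ i j, pdf.IsUniform (x i j) (Set.Icc (-1 : ℝ) 1) P volume)
    (t γ : ℝ) (ht_pos : 0 < t) (ht_lt : t < 1) (hγ_pos : 0 < γ) (hγ_le : γ ≤ 1)
    (hN : (N : ℝ) ≥
      2 * RandomEDM.theta d * (Real.log ((d : ℝ) + 2) - Real.log γ) / (1 - t) ^ 2) :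
    (∀ ω, (RandomEDM.edm fun i => WithLp.toLp 2 fun j => x i j ω).rank ≤ d + 2) ∧
    ∃ E : Set Ω, MeasurableSet E ∧ 1 - γ ≤ P.real E ∧ ∀ ω ∈ E,
      RandomEDM.AssumptionA0 (RandomEDM.edm fun i => WithLp.toLp 2 fun j => x i j ω)
        (RandomEDM.theta d / (t * ((d : ℝ) + 2))) ∧
      RandomEDM.AssumptionA1 (RandomEDM.edm fun i => WithLp.toLp 2 fun j => x i j ω)
        (RandomEDM.theta d / (t * √((d : ℝ) + 2))) := by
  exact ⟨fun ω => RandomEDM.rank_edm_le fun i j => x i j ω,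
    RandomEDM.exists_measurableSet_assumptions P N d hd x hx_meas hx_indep hx_unif t γ ht_pos
      ht_lt hγ_pos hγ_le hN⟩
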